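/- Let $K$ be an algebraically closed field of characteristic $0$ (for example $\mathbb{C}$), let $W$ be a $K$-vector space of finite dimension $n$, and let $k,d\ge 0$ be integers. Let $\mu$ be a partition of $d$, with the boxes of its Young diagram numbered $1,\dots,d$ in any way. Let $c_\mu=a_\mu b_\mu\in K[S_d]$ be the corresponding Young symmetrizer, where $a_\mu$ is the sum of the permutations preserving every row and $b_\mu=\sum \operatorname{sgn}(\sigma)\,\sigma$ is the sum over the permutations $\sigma$ preserving every column. For a representation $V$ of $GL(W)$ let $S^\mu V$ be the image of $c_\mu$ acting on $V^{\otimes d}$ by permuting tensor factors, with $GL(W)$ acting diagonally, and let $S^kW$ be the $k$-th symmetric power of $W$. Let $\chi_\mu$ be the character of the irreducible representation $K[S_d]\,c_\mu$ of $S_d$. The character of a representation $V$ of $GL(W)$ is a symmetric polynomial $P_V\in K[x_1,\dots,x_n]$ such that for every $g\in GL(W)$ the trace of $g$ on $V$ is the value of $P_V$ at the eigenvalues of $g$ (listed with algebraic multiplicity). Then the representation $S^\mu(S^kW)$ of $GL(W)$ has exactly one such character, namely \[ P_{S^\mu(S^kW)}=\sum_{\alpha\vdash d}\chi_\mu(\alpha)\,\frac{D_\alpha}{d!}\;\psi_\alpha\circ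 h_k ,\qquad \psi_\alpha\circ h_k=\prod_i h_k(x^{\alpha_i}), \] where $\alpha=(\alpha_1,\alpha_2,\dots)$ runs over all partitions of $d$, $\chi_\mu(\alpha)$ is the value of $\chi_\mu$ on any permutation of cycle type $\alpha$, $D_\alpha$ is the number of permutations of cycle type $\alpha$ in $S_d$, and $h_k(x^a)$ is the complete homogeneous symmetric polynomial of degree $k$ in the variables $x_1^a,\dots,x_n^a$. -/

import Mathlib

open scoped TensorProduct

universe u v w

noncomputable section

namespace Plethysm

/-! ### Tensor powers, symmetric powers and the standard representation -/

/-- The action of `S_d` on `V^{⊗d}` permuting the tensor factors: the factor in position `i` is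
moved to position `σ i`. -/
def permRep (K : Type u) [Field K] (V : Type v) [AddCommGroup V] [Module K V] (d : ℕ) :
    Representation K (Equiv.Perm (Fin d)) (⨂[K] _ : Fin d, V) where
  toFun σ := (PiTensorProduct.reindex K (fun _ : Fin d => V) σ).toLinearMap
  map_one' := by
    ext v
    change PiTensorProduct.reindex K (fun _ : Fin d => V) 1 (PiTensorProduct.tprod K v) = _
    rw [PiTensorProduct.reindex_tprod]
    rfl
  map_mul' σ τ := by
    ext v
    change PiTensorProduct.reindex K (fun _ : Fin d => V) (σ * τ) (PiTensorProduct.tprod K v) =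
      PiTensorProduct.reindex K (fun _ : Fin d => V) σ
        (PiTensorProduct.reindex K (fun _ : Fin d => V) τ (PiTensorProduct.tprod K v))
    rw [PiTensorProduct.reindex_tprod, PiTensorProduct.reindex_tprod]
    exact (PiTensorProduct.reindex_tprod (R := K) (s := fun _ => V) σ
      fun i => v (τ.symm i)).symm

/-- The symmetric power `S^k V`, the quotient of `V^{⊗k}` identifying a pure tensor with all its
rearrangements. (The `ULift` only adjusts the universe of the index set `{0, …, k-1}`.) -/
abbrev SymPow (K : Type u) [Field K] (k : ℕ) (V : Type v) [AddCommGroup V] [Module K V] :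
    Type (max u v) :=
  SymmetricPower K (ULift.{u} (Fin k)) V

/-- The standard representation of `GL(W)` on `W`. -/
def standardRep (K : Type u) [Field K] (W : Type v) [AddCommGroup W] [Module K W] :
    Representation K (LinearMap.GeneralLinearGroup K W) W :=
  Units.coeHom (W →ₗ[K] W)

section Representations

variable {K : Type u} [Field K] {G : Type*} [Monoid G] {V : Type v} [AddCommGroup V] [Module K V]

/-- The diagonal action of `G` on `V^{⊗d}`: `g (v₁ ⊗ ⋯ ⊗ v_d) = g v₁ ⊗ ⋯ ⊗ g v_d`. -/
def tensorPowerRep (d : ℕ) (ρ : Representation K G V) :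
    Representation K G (⨂[K] _ : Fin d, V) where
  toFun g := PiTensorProduct.map fun _ => ρ g
  map_one' := by
    simp only [map_one]
    exact PiTensorProduct.map_one
  map_mul' g h := by
    simp only [map_mul]
    exact PiTensorProduct.map_mul _ _

/-- The linear map `S^k f : S^k V → S^k V'`, `v₁ ⋯ v_k ↦ f v₁ ⋯ f v_k`, induced by `f`. -/
def symPowMap (k : ℕ) {V' : Type w} [AddCommGroup V'] [Module K V'] (f : V →ₗ[K] V') :
    SymPow K k V →ₗ[K] SymPow K k V' where
  __ := AddCon.lift _
    ((SymmetricPower.mk K (ULift.{u} (Fin k)) V' ∘ₗ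
      PiTensorProduct.map fun _ => f).toAddMonoidHom) (by
        refine AddCon.addConGen_le.2 ?_
        rintro _ _ ⟨e, v⟩
        simp only [AddCon.ker_rel, LinearMap.toAddMonoidHom_coe, LinearMap.comp_apply,
          PiTensorProduct.map_tprod]
        exact (SymmetricPower.tprod_equiv e fun i => f (v i)).symm)
  map_smul' r x := by
    induction x using AddCon.induction_on with
    | H x => exact LinearMap.map_smul (SymmetricPower.mk K (ULift.{u} (Fin k)) V' ∘ₗ
      PiTensorProduct.map fun _ => f) r x

theorem symPowMap_tprod (k : ℕ) {V' : Type w} [AddCommGroup V'] [Module K V'] (f : V →ₗ[K] V')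
    (v : ULift.{u} (Fin k) → V) :
    symPowMap k f (SymmetricPower.tprod K v) = SymmetricPower.tprod K fun i => f (v i) := by
  change SymmetricPower.mk K (ULift.{u} (Fin k)) V'
    (PiTensorProduct.map (fun _ => f) (PiTensorProduct.tprod K v)) = _
  rw [PiTensorProduct.map_tprod]
  rfl

theorem symPow_hom_ext {k : ℕ} {M : Type*} [AddCommGroup M] [Module K M]
    {f g : SymPow K k V →ₗ[K] M}
    (h : ∀ v, f (SymmetricPower.tprod K v) = g (SymmetricPower.tprod K v)) : f = g := by
  apply LinearMap.ext_on_range (SymmetricPower.span_tprod_eq_top K (ULift.{u} (Fin k)) V)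
  exact h

/-- The action of `G` on the symmetric power `S^k V` of a representation `V`. -/
def symPowRep (k : ℕ) (ρ : Representation K G V) : Representation K G (SymPow K k V) where
  toFun g := symPowMap k (ρ g)
  map_one' := symPow_hom_ext fun v => by simp [symPowMap_tprod]
  map_mul' g h := symPow_hom_ext fun v => by simp [symPowMap_tprod]

end Representations

/-! ### Young symmetrizers, Schur functors and the irreducible characters of `S_d`

A Young diagram `μ` with `d` boxes comes with a numbering `T : Fin d ≃ μ.cells` of its boxes; the
first coordinate of a box is its row, the second its column. -/

section Young

variable {d : ℕ} {μ : YoungDiagram}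

/-- `a_μ`, the sum of the permutations that preserve each row of the numbered diagram. -/
def rowSymmetrizer (K : Type u) [Field K] (T : Fin d ≃ μ.cells) :
    MonoidAlgebra K (Equiv.Perm (Fin d)) :=
  ∑ σ : Equiv.Perm (Fin d) with ∀ i, (T (σ i)).1.1 = (T i).1.1, MonoidAlgebra.single σ 1

/-- `b_μ`, the signed sum of the permutations that preserve each column of the numbered
diagram. -/
def colAntisymmetrizer (K : Type u) [Field K] (T : Fin d ≃ μ.cells) :
    MonoidAlgebra K (Equiv.Perm (Fin d)) :=
  ∑ σ : Equiv.Perm (Fin d) with ∀ i, (T (σ i)).1.2 = (T i).1.2,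
    MonoidAlgebra.single σ ((Equiv.Perm.sign σ : ℤ) : K)

/-- The Young symmetrizer `c_μ = a_μ b_μ`. -/
def youngSymmetrizer (K : Type u) [Field K] (T : Fin d ≃ μ.cells) :
    MonoidAlgebra K (Equiv.Perm (Fin d)) :=
  rowSymmetrizer K T * colAntisymmetrizer K T

/-- The Schur functor on objects: `S^μ V` is the image of `c_μ` acting on `V^{⊗d}`. -/
def schurSubmodule {K : Type u} [Field K] (T : Fin d ≃ μ.cells) (V : Type v) [AddCommGroup V]
    [Module K V] : Submodule K (⨂[K] _ : Fin d, V) :=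
  LinearMap.range ((permRep K V d).asAlgebraHom (youngSymmetrizer K T))

theorem tensorPowerRep_commute_permRep {K : Type u} [Field K] {G : Type*} [Monoid G] {V : Type v}
    [AddCommGroup V] [Module K V] (ρ : Representation K G V) (g : G)
    (c : MonoidAlgebra K (Equiv.Perm (Fin d))) :
    Commute (tensorPowerRep d ρ g) ((permRep K V d).asAlgebraHom c) := by
  induction c using MonoidAlgebra.induction_on with
  | of σ =>
    rw [commute_iff_eq]
    ext v
    simp [tensorPowerRep, permRep, PiTensorProduct.reindex_tprod]
  | add a b ha hb => rw [map_add]; exact ha.add_right hb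
  | smul r a ha => rw [map_smul]; exact ha.smul_right r

/-- The representation `S^μ V` of `G` obtained from a representation `V` of `G`, as a
subrepresentation of `V^{⊗d}`. -/
def schurRep {K : Type u} [Field K] {G : Type*} [Monoid G] {V : Type v} [AddCommGroup V]
    [Module K V] (T : Fin d ≃ μ.cells) (ρ : Representation K G V) :
    Representation K G (schurSubmodule (K := K) T V) :=
  (tensorPowerRep d ρ).subrepresentation (schurSubmodule T V) (by
    rintro g _ ⟨x, rfl⟩
    exact ⟨tensorPowerRep d ρ g x,
      (LinearMap.congr_fun (tensorPowerRep_commute_permRep ρ g (youngSymmetrizer K T)) x).symm⟩)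

/-- The left ideal `K[S_d] c_μ` of the group algebra, as a subspace. -/
def spechtSubmodule (K : Type u) [Field K] (T : Fin d ≃ μ.cells) :
    Submodule K (MonoidAlgebra K (Equiv.Perm (Fin d))) :=
  LinearMap.range (LinearMap.mulRight K (youngSymmetrizer K T))

/-- The irreducible representation of `S_d` attached to `μ`: its space is the left ideal
`K[S_d] c_μ` of the group algebra, on which `σ` acts by left multiplication. -/
def spechtRep (K : Type u) [Field K] (T : Fin d ≃ μ.cells) :
    Representation K (Equiv.Perm (Fin d)) (spechtSubmodule K T) where
  toFun σ := (LinearMap.mulLeft K (MonoidAlgebra.of K (Equiv.Perm (Fin d)) σ)).restrict (by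
    rintro _ ⟨x, rfl⟩
    exact ⟨MonoidAlgebra.of K (Equiv.Perm (Fin d)) σ * x, by simp [mul_assoc]⟩)
  map_one' := by
    ext x : 2
    simp only [map_one, LinearMap.coe_restrict_apply, LinearMap.mulLeft_apply, one_mul,
      Module.End.one_apply]
  map_mul' σ τ := by
    ext x : 2
    simp only [map_mul, LinearMap.coe_restrict_apply, LinearMap.mulLeft_apply, Module.End.mul_apply,
      mul_assoc]

/-- `σ ∈ S_d` has cycle type `α`, fixed points being counted as parts equal to `1`. -/
def HasCycleType (σ : Equiv.Perm (Fin d)) (α : d.Partition) : Prop :=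
  σ.partition.parts = α.parts

/-- `D_α`, the number of permutations in `S_d` of cycle type `α`. -/
def numCycleType (α : d.Partition) : ℕ :=
  Nat.card {σ : Equiv.Perm (Fin d) // HasCycleType σ α}

theorem exists_hasCycleType (α : d.Partition) : ∃ σ : Equiv.Perm (Fin d), HasCycleType σ α := by
  have hsplit := Multiset.filter_add_not (fun n => 2 ≤ n) α.parts
  have hone : α.parts.filter (fun n => ¬ 2 ≤ n) =
      Multiset.replicate (α.parts.filter fun n => ¬ 2 ≤ n).card 1 :=
    Multiset.eq_replicate_card.2 fun n hn => by
      have h := Multiset.mem_filter.1 hn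
      have := α.parts_pos h.1
      omega
  have hsum : (α.parts.filter fun n => 2 ≤ n).sum +
      (α.parts.filter fun n => ¬ 2 ≤ n).card = d := by
    have h := congrArg Multiset.sum hsplit
    rw [Multiset.sum_add, α.parts_sum, hone, Multiset.sum_replicate] at h
    simpa using h
  obtain ⟨σ, hσ⟩ := (Equiv.Perm.exists_with_cycleType_iff (Fin d)
    (m := α.parts.filter fun n => 2 ≤ n)).2
    ⟨by rw [Fintype.card_fin]; omega, fun a ha => (Multiset.mem_filter.1 ha).2⟩
  refine ⟨σ, ?_⟩
  rw [HasCycleType, Equiv.Perm.parts_partition, ← Equiv.Perm.sum_cycleType, hσ, Fintype.card_fin,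
    Nat.sub_eq_of_eq_add' hsum.symm, ← hone]
  exact hsplit

/-- `χ_μ(α)`, the value of the character of the irreducible representation of `S_d` attached to
`μ` on a permutation of cycle type `α` (any one, by `spechtCharacter_eq`). -/
def spechtCharacter (K : Type u) [Field K] (T : Fin d ≃ μ.cells) (α : d.Partition) : K :=
  (spechtRep K T).character (exists_hasCycleType α).choose

theorem spechtCharacter_eq (K : Type u) [Field K] (T : Fin d ≃ μ.cells) {α : d.Partition}
    {σ : Equiv.Perm (Fin d)} (hσ : HasCycleType σ α) :
    (spechtRep K T).character σ = spechtCharacter K T α := by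
  have h : IsConj (exists_hasCycleType α).choose σ :=
    Equiv.Perm.partition_eq_of_isConj.2
      (Nat.Partition.ext ((exists_hasCycleType α).choose_spec.trans hσ.symm))
  obtain ⟨τ, hτ⟩ := isConj_iff.1 h
  rw [← hτ, Representation.char_mul_comm, inv_mul_cancel_left, spechtCharacter]

end Young

/-! ### Characters of `GL(W)` as symmetric polynomials -/

/-- `P` is the character of the representation `ρ` of `GL(W)`: a symmetric polynomial in `dim W`
variables such that the trace of `ρ g` is the value of `P` at the eigenvalues of `g`, listed with
their algebraic multiplicities. -/
def IsGLCharacter {K : Type u} [Field K] {W : Type v} [AddCommGroup W] [Module K W]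
    [FiniteDimensional K W] {V : Type w} [AddCommMonoid V] [Module K V]
    (ρ : Representation K (LinearMap.GeneralLinearGroup K W) V)
    (P : MvPolynomial (Fin (Module.finrank K W)) K) : Prop :=
  P.IsSymmetric ∧
    ∀ (g : LinearMap.GeneralLinearGroup K W) (x : Fin (Module.finrank K W) → K),
      (g : W →ₗ[K] W).charpoly = ∏ i, (Polynomial.X - Polynomial.C (x i)) →
        LinearMap.trace K V (ρ g) = MvPolynomial.eval x P

/-- `ψ_α ∘ h_k = ∏ᵢ h_k(x^{αᵢ})` in `n` variables, where `h_k(x^a)` is the complete homogeneous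
symmetric polynomial of degree `k` in `x₁^a, …, x_n^a`. -/
def psiCompH (K : Type u) [Field K] (n k : ℕ) {d : ℕ} (α : d.Partition) :
    MvPolynomial (Fin n) K :=
  (α.parts.map fun a => MvPolynomial.expand a (MvPolynomial.hsymm (Fin n) K k)).prod

end Plethysm

end

open Plethysm

noncomputable section

namespace Plethysm

open Module

/-! ### Triangular bases -/

/-! Write V = S^k W and c for the Young symmetrizer. The group algebra is semisimple, so c x c = c
for some x (`exists_mul_mul_eq_self`), and e = x c is an idempotent generating the left ideal of c.
Both sides of the formula are traces involving e. On S^μ V the trace of g is ∑ e_σ tr(g σ | V^{⊗d}),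
while χ_μ(σ) = ∑_z e(z⁻¹ σ⁻¹ z). Since φ(σ) = tr(g σ | V^{⊗d}) is invariant under conjugation and
inversion, ∑ χ_μ(σ) φ(σ) = d! ∑ e_τ φ(τ) (`sum_trace_mul_classFunction`). Irreducibility of the
Specht module plays no role.

It remains to compute φ. In a triangular basis only index tuples constant on the cycles of σ
contribute, so φ(σ) is the product of tr(g^a | V) over cycle lengths a
(`trace_map_comp_reindex_eq_prod`). The same trace formula, averaged over S_k, gives tr(g^a | S^k W)
= h_k(x^a) (`trace_symPowMap_pow`). Uniqueness follows by testing on invertible diagonal matrices.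
-/

theorem exists_isLowerTriangular_basis {K : Type u} [Field K] [IsAlgClosed K] (n : ℕ) :
    ∀ {V : Type v} [AddCommGroup V] [Module K V] [FiniteDimensional K V],
      finrank K V = n → ∀ f : V →ₗ[K] V,
        ∃ b : Basis (Fin n) K V, (LinearMap.toMatrix b b f).IsLowerTriangular := by
  induction n with
  | zero =>
    intro V _ _ _ h f
    exact ⟨finBasisOfFinrankEq K V h, fun i => i.elim0⟩
  | succ n ih =>
    intro V _ _ _ h f
    have : Nontrivial V := nontrivial_of_finrank_pos (R := K) (by omega)
    obtain ⟨c, hc⟩ := Module.End.exists_eigenvalue f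
    have hlt : LinearMap.range (f - algebraMap K (Module.End K V) c) < ⊤ := by
      rw [lt_top_iff_ne_top, ne_eq, LinearMap.range_eq_top, ← LinearMap.injective_iff_surjective,
        ← LinearMap.ker_eq_bot]
      rwa [Module.End.hasEigenvalue_iff, Module.End.eigenspace_def] at hc
    -- A hyperplane H containing the range of f - c is f-invariant, as f acts on V/H by the scalar
    -- c. Putting a vector y outside H in front of a triangular basis of H keeps the matrix lower
    -- triangular, because f maps H to vectors with no y-coordinate.
    obtain ⟨H, hH, hle⟩ := (eq_top_or_exists_le_coatom
      (LinearMap.range (f - algebraMap K (Module.End K V) c))).resolve_left hlt.ne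
    have hmem (x : V) : f x - c • x ∈ H := hle ⟨x, by simp⟩
    have hinv : ∀ x ∈ H, f x ∈ H := fun x hx => by
      simpa using H.add_mem (hmem x) (H.smul_mem c hx)
    obtain ⟨y, hy⟩ : ∃ y, y ∉ H := by
      by_contra! hall
      exact hH.1 (eq_top_iff.2 fun x _ => hall x)
    have hspan : H ⊔ K ∙ y = ⊤ := by
      refine hH.2 _ (lt_of_le_of_ne le_sup_left fun he => hy ?_)
      rw [he]
      exact Submodule.mem_sup_right (Submodule.mem_span_singleton_self y)
    have hli : ∀ (a : K), ∀ x ∈ H, a • y + x = 0 → a = 0 := by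
      intro a x hx h0
      by_contra ha
      apply hy
      have : a • y ∈ H := by
        rw [eq_neg_of_add_eq_zero_left h0]
        exact H.neg_mem hx
      exact (H.smul_mem_iff ha).1 this
    have hsp : ∀ z : V, ∃ a : K, z + a • y ∈ H := by
      intro z
      have hz : z ∈ H ⊔ K ∙ y := by rw [hspan]; trivial
      obtain ⟨x, hx, w, hw, rfl⟩ := Submodule.mem_sup.1 hz
      obtain ⟨a, rfl⟩ := Submodule.mem_span_singleton.1 hw
      exact ⟨-a, by simpa using hx⟩
    have hfin : finrank K H = n := by
      have h1 := Submodule.finrank_sup_add_finrank_inf_eq H (K ∙ y)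
      have h2 : H ⊓ K ∙ y = ⊥ := by
        rw [← disjoint_iff, Submodule.disjoint_span_singleton]
        exact fun hy' => absurd hy' hy
      rw [hspan, h2, finrank_top, finrank_bot, finrank_span_singleton
        (by rintro rfl; exact hy H.zero_mem), h] at h1
      omega
    obtain ⟨b, hb⟩ := ih hfin (f.restrict hinv)
    refine ⟨Basis.mkFinCons y b hli hsp, ?_⟩
    set B := Basis.mkFinCons y b hli hsp with hB
    have hsucc (x : H) (i : Fin n) : B.repr (x : V) i.succ = b.repr x i := by
      rw [← b.sum_repr x]
      simp only [Submodule.coe_sum, Submodule.coe_smul, map_sum, map_smul, Finsupp.coe_finsetSum,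
        Finset.sum_apply, Finsupp.smul_apply, smul_eq_mul]
      refine Finset.sum_congr rfl fun j _ => ?_
      have : (b j : V) = B j.succ := by simp [hB]
      rw [this, B.repr_self, b.repr_self, Finsupp.single_apply, Finsupp.single_apply]
      simp
    have hzero (x : H) : B.repr (x : V) 0 = 0 := by
      rw [← b.sum_repr x]
      simp only [Submodule.coe_sum, Submodule.coe_smul, map_sum, map_smul, Finsupp.coe_finsetSum,
        Finset.sum_apply, Finsupp.smul_apply, smul_eq_mul]
      refine Finset.sum_eq_zero fun j _ => ?_
      have : (b j : V) = B j.succ := by simp [hB]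
      rw [this, B.repr_self, Finsupp.single_apply]
      simp
    intro i j hij
    rw [LinearMap.toMatrix_apply]
    have hij : i < j := hij
    obtain ⟨j, rfl⟩ := Fin.exists_succ_eq.2 (Fin.ne_zero_of_lt hij)
    have hBj : f (B j.succ) = (f.restrict hinv (b j) : V) := by simp [hB]
    rw [hBj]
    rcases Fin.eq_zero_or_eq_succ i with rfl | ⟨i, rfl⟩
    · exact hzero _
    · rw [hsucc]
      simpa [LinearMap.toMatrix_apply] using hb (Fin.succ_lt_succ_iff.1 hij)

theorem _root_.Matrix.IsLowerTriangular.pow_and_diag {K : Type*} [Field K] {n : ℕ}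
    {M : Matrix (Fin n) (Fin n) K} (hM : M.IsLowerTriangular) (a : ℕ) :
    (M ^ a).IsLowerTriangular ∧ ∀ i, (M ^ a) i i = M i i ^ a := by
  induction a with
  | zero => exact ⟨by rw [pow_zero]; exact Matrix.blockTriangular_one, fun i => by simp⟩
  | succ a ih =>
    refine ⟨by rw [pow_succ]; exact ih.1.mul hM, fun i => ?_⟩
    rw [pow_succ, Matrix.mul_apply, Finset.sum_eq_single i, ih.2, pow_succ]
    · intro j _ hj
      rcases lt_or_gt_of_ne hj with h | h
      · rw [hM h, mul_zero]
      · rw [ih.1 h, zero_mul]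
    · simp

/-! ### Traces of permuted tensor powers -/

section Trace

variable {K : Type u} [Field K] {V : Type v} [AddCommGroup V] [Module K V] {n : ℕ}
  {ι : Type*} [Fintype ι] [DecidableEq ι]

/-- The diagonal entry at p is the product of the matrix entries at (p i, p (σ⁻¹ i)). Triangularity
makes it vanish unless p (σ⁻¹ i) ≤ p i for every i; both sides have the same sum over i, so all
these inequalities are then equalities. -/
theorem trace_map_comp_reindex (b : Basis (Fin n) K V) (f : V →ₗ[K] V)
    (hf : (LinearMap.toMatrix b b f).IsLowerTriangular) (σ : Equiv.Perm ι) :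
    LinearMap.trace K (⨂[K] _ : ι, V) (PiTensorProduct.map (fun _ => f) ∘ₗ
        (PiTensorProduct.reindex K (fun _ : ι => V) σ).toLinearMap) =
      ∑ p : ι → Fin n with p ∘ σ = p, ∏ i, LinearMap.toMatrix b b f (p i) (p i) := by
  classical
  rw [LinearMap.trace_eq_matrix_trace K (Basis.piTensorProduct fun _ : ι => b), Matrix.trace,
    Finset.sum_filter]
  refine Finset.sum_congr rfl fun p _ => ?_
  have key : (LinearMap.toMatrix (Basis.piTensorProduct fun _ : ι => b)
      (Basis.piTensorProduct fun _ : ι => b)) (PiTensorProduct.map (fun _ => f) ∘ₗ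
        (PiTensorProduct.reindex K (fun _ : ι => V) σ).toLinearMap) p p =
      ∏ i, LinearMap.toMatrix b b f (p i) (p (σ.symm i)) := by
    rw [LinearMap.toMatrix_apply, Basis.piTensorProduct_apply]
    have h : (PiTensorProduct.map (fun _ => f) ∘ₗ
        (PiTensorProduct.reindex K (fun _ : ι => V) σ).toLinearMap)
          (PiTensorProduct.tprod K fun i => b (p i)) =
        PiTensorProduct.tprod K fun i => f (b (p (σ.symm i))) := by
      rw [LinearMap.comp_apply, LinearEquiv.coe_coe, PiTensorProduct.reindex_tprod]
      exact PiTensorProduct.map_tprod _ _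
    rw [h, Basis.piTensorProduct_repr_tprod_apply]
    simp [LinearMap.toMatrix_apply]
  rw [Matrix.diag_apply, key]
  split_ifs with hp
  · refine Finset.prod_congr rfl fun i _ => ?_
    rw [← congrFun hp (σ.symm i)]
    simp
  · by_contra hne
    apply hp
    have hle : ∀ i ∈ Finset.univ, (p (σ.symm i) : ℕ) ≤ p i := fun i _ => by
      by_contra! hlt
      exact hne (Finset.prod_eq_zero (Finset.mem_univ i) (hf hlt))
    have hs : ∑ i, (p (σ.symm i) : ℕ) = ∑ i, (p i : ℕ) :=
      Equiv.sum_comp σ.symm fun i => (p i : ℕ)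
    have := (Finset.sum_eq_sum_iff_of_le hle).1 hs
    funext i
    have h := this (σ i) (Finset.mem_univ _)
    simp only [Equiv.symm_apply_apply] at h
    exact (Fin.ext h).symm

end Trace

/-! ### Sums over functions constant on cycles -/

/-- The cycles of `σ`, fixed points included. -/
abbrev CycleIndex {ι : Type*} [Fintype ι] [DecidableEq ι] (σ : Equiv.Perm ι) : Type _ :=
  {c // c ∈ σ.cycleFactorsFinset} ⊕ {i // σ i = i}

section Cycles

variable {ι : Type*} [Fintype ι] [DecidableEq ι] (σ : Equiv.Perm ι)

/-- The cycle of `σ` through a point. -/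
def cycleIndex (i : ι) : CycleIndex σ :=
  if h : σ i = i then .inr ⟨i, h⟩ else
    .inl ⟨σ.cycleOf i, Equiv.Perm.cycleOf_mem_cycleFactorsFinset_iff.2
      (Equiv.Perm.mem_support.2 h)⟩

theorem cycleIndex_eq_inl_iff (c : {c // c ∈ σ.cycleFactorsFinset}) (i : ι) :
    cycleIndex σ i = .inl c ↔ i ∈ c.1.support := by
  rw [← Equiv.Perm.eq_cycleOf_of_mem_cycleFactorsFinset_iff σ c.1 c.2, cycleIndex]
  split_ifs with h
  · have : c.1 ≠ σ.cycleOf i := by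
      rintro hc
      have h2 := c.2
      rw [hc, Equiv.Perm.cycleOf_mem_cycleFactorsFinset_iff, Equiv.Perm.mem_support] at h2
      exact h2 h
    simpa using this
  · rw [Sum.inl.injEq, Subtype.ext_iff, eq_comm]

theorem cycleIndex_eq_inr_iff (j : {i // σ i = i}) (i : ι) :
    cycleIndex σ i = .inr j ↔ i = j := by
  rw [cycleIndex]
  split_ifs with h
  · rw [Sum.inr.injEq, Subtype.ext_iff]
  · simp only [false_iff]
    rintro rfl
    exact h j.2

theorem cycleIndex_surjective : Function.Surjective (cycleIndex σ) := by
  rintro (c | j)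
  · obtain ⟨i, hi⟩ := (Equiv.Perm.mem_cycleFactorsFinset_iff.1 c.2).1.nonempty_support
    exact ⟨i, (cycleIndex_eq_inl_iff σ c i).2 hi⟩
  · exact ⟨j, (cycleIndex_eq_inr_iff σ j j).2 rfl⟩

theorem cycleIndex_apply (i : ι) : cycleIndex σ (σ i) = cycleIndex σ i := by
  rcases h : cycleIndex σ i with c | j
  · rw [cycleIndex_eq_inl_iff] at h ⊢
    rw [← Equiv.Perm.eq_cycleOf_of_mem_cycleFactorsFinset_iff σ c.1 c.2] at h ⊢
    rw [h, Equiv.Perm.SameCycle.cycleOf_eq]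
    simp [Equiv.Perm.SameCycle.rfl]
  · rw [cycleIndex_eq_inr_iff] at h ⊢
    rw [h, j.2]

theorem eq_of_cycleIndex_eq {κ : Type*} {p : ι → κ} (hp : p ∘ σ = p) {i j : ι}
    (h : cycleIndex σ i = cycleIndex σ j) : p i = p j := by
  have hpow (m : ℕ) : p ∘ (σ ^ m : Equiv.Perm ι) = p := by
    induction m with
    | zero => rfl
    | succ m ih => rw [pow_succ, Equiv.Perm.coe_mul, ← Function.comp_assoc, ih, hp]
  rcases hj : cycleIndex σ j with c | l
  · rw [hj] at h
    rw [cycleIndex_eq_inl_iff,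
      ← Equiv.Perm.eq_cycleOf_of_mem_cycleFactorsFinset_iff σ c.1 c.2] at h
    rw [cycleIndex_eq_inl_iff] at hj
    have hs : σ.SameCycle i j := by
      rw [h] at hj
      exact (Equiv.Perm.mem_support_cycleOf_iff.1 hj).1
    obtain ⟨m, -, -, rfl⟩ := hs.exists_pow_eq
    exact (congrFun (hpow m) i).symm
  · rw [hj] at h
    rw [cycleIndex_eq_inr_iff] at h hj
    rw [h, hj]

/-- A σ-invariant p is an arbitrary function on the set of cycles, and a cycle of length a
contributes a factor x_j ^ a; distributivity turns the sum over functions into a product of power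
sums. Fixed points are treated separately because `cycleType` omits them, whereas `partition`
records them as parts 1. -/
theorem sum_prod_fixed {κ : Type*} [Fintype κ] [DecidableEq κ]
    {R : Type*} [CommRing R] (x : κ → R) :
    ∑ p : ι → κ with p ∘ σ = p, ∏ i, x (p i) =
      (σ.partition.parts.map fun a => ∑ j, x j ^ a).prod := by
  have h1 : ∑ p : ι → κ with p ∘ σ = p, ∏ i, x (p i) =
      ∑ q : CycleIndex σ → κ, ∏ i, x (q (cycleIndex σ i)) := by
    refine (Finset.sum_bij (fun q _ => q ∘ cycleIndex σ) ?_ ?_ ?_ ?_).symm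
    · intro q _
      rw [Finset.mem_filter]
      exact ⟨Finset.mem_univ _, funext fun i => congrArg q (cycleIndex_apply σ i)⟩
    · exact fun q _ q' _ h => (cycleIndex_surjective σ).injective_comp_right h
    · intro p hp
      refine ⟨fun c => p (Function.surjInv (cycleIndex_surjective σ) c), Finset.mem_univ _, ?_⟩
      funext i
      exact eq_of_cycleIndex_eq σ (Finset.mem_filter.1 hp).2
        (Function.surjInv_eq (cycleIndex_surjective σ) _)
    · exact fun q _ => rfl
  have h2 (q : CycleIndex σ → κ) : ∏ i, x (q (cycleIndex σ i)) =
      ∏ c, x (q c) ^ (Finset.univ.filter fun i => cycleIndex σ i = c).card := by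
    rw [← Finset.prod_fiberwise Finset.univ (cycleIndex σ)]
    refine Finset.prod_congr rfl fun c _ => ?_
    rw [Finset.prod_congr rfl fun i hi => by rw [(Finset.mem_filter.1 hi).2], Finset.prod_const]
  rw [h1, Finset.sum_congr rfl fun q _ => h2 q, ← Fintype.piFinset_univ,
    ← Finset.prod_univ_sum (fun _ => Finset.univ)
      (fun c j => x j ^ (Finset.univ.filter fun i => cycleIndex σ i = c).card),
    Fintype.prod_sum_type, Equiv.Perm.parts_partition, Multiset.map_add, Multiset.prod_add]
  congr 1
  · rw [Equiv.Perm.cycleType_def, Multiset.map_map]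
    have (c : {c // c ∈ σ.cycleFactorsFinset}) :
        (Finset.univ.filter fun i => cycleIndex σ i = .inl c) = c.1.support := by
      ext i
      simp [cycleIndex_eq_inl_iff]
    simp only [this]
    exact Finset.prod_coe_sort σ.cycleFactorsFinset fun c => ∑ j, x j ^ c.support.card
  · have (j : {i // σ i = i}) : (Finset.univ.filter fun i => cycleIndex σ i = .inr j) = {j.1} := by
      ext i
      simp [cycleIndex_eq_inr_iff]
    simp only [this, Finset.card_singleton, Finset.prod_const, Multiset.map_replicate,
      Multiset.prod_replicate]
    congr 1
    rw [Finset.card_univ, Fintype.card_subtype, Equiv.Perm.support, ← Finset.card_compl]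
    congr 1
    ext i
    simp

end Cycles

/-! ### Complete homogeneous symmetric polynomials and Burnside counting -/

/-- Equal multisets of values mean fibres of equal size; bijections between corresponding fibres
glue to a permutation. -/
theorem exists_perm_comp_eq {ι κ : Type*} [Fintype ι] {p q : ι → κ}
    (h : Multiset.map p Finset.univ.val = Multiset.map q Finset.univ.val) :
    ∃ σ : Equiv.Perm ι, q ∘ σ = p := by
  classical
  have hc (c : κ) : Nonempty ({i // p i = c} ≃ {i // q i = c}) := by
    rw [← Fintype.card_eq, Fintype.card_subtype, Fintype.card_subtype]
    have := congrArg (Multiset.count c) h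
    rw [Multiset.count_map, Multiset.count_map] at this
    simp only [eq_comm (a := c)] at this
    exact this
  exact ⟨Equiv.ofFiberEquiv fun c => (hc c).some, funext fun i => Equiv.ofFiberEquiv_map _ i⟩

theorem map_comp_perm {ι κ : Type*} [Fintype ι] (p : ι → κ) (σ : Equiv.Perm ι) :
    Multiset.map (p ∘ σ) Finset.univ.val = Multiset.map p Finset.univ.val := by
  rw [← Multiset.map_map]
  congr 1
  exact Multiset.map_univ_val_equiv σ

theorem exists_map_univ_eq {ι κ : Type*} [Fintype ι] {k : ℕ} (hk : Fintype.card ι = k)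
    (s : Sym κ k) : ∃ p : ι → κ, Multiset.map p Finset.univ.val = s.1 := by
  obtain ⟨l, hl⟩ := Quotient.exists_rep s.1
  have hlen : Fintype.card ι = l.length := by
    rw [hk, ← s.2, ← hl]
    rfl
  let e : ι ≃ Fin l.length := Fintype.equivFinOfCardEq hlen
  refine ⟨l.get ∘ e, ?_⟩
  rw [← Multiset.map_map, Multiset.map_univ_val_equiv e, ← hl, Fin.univ_val_map, List.ofFn_get]
  rfl

/-- Orbit–stabilizer: the tuples with value multiset s form one orbit, that of p₀. Sorting all k!
permutations σ by p₀ ∘ σ, the class belonging to p = p₀ ∘ τ is the coset of the stabilizer of p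
translated by τ. -/
theorem card_stabilizer_sum {ι κ : Type*} [Fintype ι] [DecidableEq ι] [Fintype κ] [DecidableEq κ]
    {k : ℕ} (hk : Fintype.card ι = k) (s : Sym κ k) :
    ∑ p : ι → κ with Multiset.map p Finset.univ.val = s.1,
      (Finset.univ.filter fun σ : Equiv.Perm ι => p ∘ σ = p).card = k.factorial := by
  obtain ⟨p₀, hp₀⟩ := exists_map_univ_eq hk s
  subst hk
  refine Eq.trans ?_ ((Finset.card_eq_sum_card_fiberwise (s := Finset.univ)
    (f := fun σ : Equiv.Perm ι => p₀ ∘ σ)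
    (t := Finset.univ.filter fun p : ι → κ => Multiset.map p Finset.univ.val = s.1)
      ?_).symm.trans (Finset.card_univ.trans Fintype.card_perm))
  · refine Finset.sum_congr rfl fun p hp => ?_
    obtain ⟨τ, rfl⟩ := exists_perm_comp_eq ((Finset.mem_filter.1 hp).2.trans hp₀.symm)
    refine Finset.card_bij (fun σ _ => τ * σ) ?_ ?_ ?_
    · intro σ hσ
      rw [Finset.mem_filter] at hσ ⊢
      exact ⟨Finset.mem_univ _, hσ.2⟩
    · exact fun _ _ _ _ h => mul_left_cancel h
    · intro σ hσ
      refine ⟨τ⁻¹ * σ, ?_, mul_inv_cancel_left _ _⟩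
      rw [Finset.mem_filter] at hσ ⊢
      refine ⟨Finset.mem_univ _, ?_⟩
      rw [Function.comp_assoc, ← Equiv.Perm.coe_mul, mul_inv_cancel_left]
      exact hσ.2
  · intro σ _
    simp only [Finset.coe_filter, Finset.mem_univ, true_and, Set.mem_ofPred_eq]
    rw [map_comp_perm, hp₀]

/-- After exchanging the sums, each tuple is weighted by the order of its stabilizer, so each
monomial of h_k occurs k! times in total. -/
theorem sum_perm_sum_fixed {ι κ : Type*} [Fintype ι] [DecidableEq ι] [Fintype κ] [DecidableEq κ]
    {K : Type*} [Field K] {k : ℕ} (hk : Fintype.card ι = k) (x : κ → K) :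
    ∑ σ : Equiv.Perm ι, ∑ p : ι → κ with p ∘ σ = p, ∏ i, x (p i) =
      k.factorial * MvPolynomial.eval x (MvPolynomial.hsymm κ K k) := by
  have h1 : ∑ σ : Equiv.Perm ι, ∑ p : ι → κ with p ∘ σ = p, ∏ i, x (p i) =
      ∑ p : ι → κ, (Finset.univ.filter fun σ : Equiv.Perm ι => p ∘ σ = p).card *
        ∏ i, x (p i) := by
    simp only [Finset.sum_filter]
    rw [Finset.sum_comm]
    refine Finset.sum_congr rfl fun p _ => ?_
    rw [← Finset.sum_filter, Finset.sum_const, nsmul_eq_mul]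
  let m (p : ι → κ) : Sym κ k := ⟨Multiset.map p Finset.univ.val, by simp [hk]⟩
  rw [h1, ← Finset.sum_fiberwise Finset.univ m, MvPolynomial.hsymm, map_sum, Finset.mul_sum]
  refine Finset.sum_congr rfl fun s _ => ?_
  have hm (p : ι → κ) : m p = s ↔ Multiset.map p Finset.univ.val = s.1 := Subtype.ext_iff
  simp only [hm]
  rw [← card_stabilizer_sum hk s, Nat.cast_sum, Finset.sum_mul]
  refine Finset.sum_congr rfl fun p hp => ?_
  rw [← (Finset.mem_filter.1 hp).2, Multiset.map_map]
  congr 1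
  rw [← Finset.prod, map_prod]
  simp

theorem eval_hsymm_congr {κ : Type*} [Fintype κ] [DecidableEq κ] {K : Type*} [Field K]
    {x y : κ → K} (k : ℕ)
    (h : Multiset.map x Finset.univ.val = Multiset.map y Finset.univ.val) :
    MvPolynomial.eval x (MvPolynomial.hsymm κ K k) =
      MvPolynomial.eval y (MvPolynomial.hsymm κ K k) := by
  obtain ⟨σ, rfl⟩ := exists_perm_comp_eq h
  rw [← MvPolynomial.eval_rename, MvPolynomial.hsymm_isSymmetric]

/-! ### Symmetric powers -/

section SymPow

variable {K : Type u} [Field K] {V : Type v} [AddCommGroup V] [Module K V]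

/-- The average of a tensor over all permutations of its factors. -/
def symmetrizeTensor (K : Type u) [Field K] (k : ℕ) (V : Type v) [AddCommGroup V] [Module K V] :
    (⨂[K] _ : ULift.{u} (Fin k), V) →ₗ[K] ⨂[K] _ : ULift.{u} (Fin k), V :=
  (k.factorial : K)⁻¹ • ∑ σ : Equiv.Perm (ULift.{u} (Fin k)),
    (PiTensorProduct.reindex K (fun _ => V) σ).toLinearMap

theorem symmetrizeTensor_tprod (k : ℕ) (v : ULift.{u} (Fin k) → V) :
    symmetrizeTensor K k V (PiTensorProduct.tprod K v) =
      (k.factorial : K)⁻¹ • ∑ σ : Equiv.Perm (ULift.{u} (Fin k)),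
        PiTensorProduct.tprod K fun i => v (σ.symm i) := by
  rw [symmetrizeTensor, LinearMap.smul_apply, LinearMap.sum_apply]
  congr 1
  refine Finset.sum_congr rfl fun σ _ => ?_
  rw [LinearEquiv.coe_coe, PiTensorProduct.reindex_tprod]

/-- The section of the projection `V^{⊗k} → S^k V` given by averaging. -/
def symPowSection (K : Type u) [Field K] (k : ℕ) (V : Type v) [AddCommGroup V] [Module K V] :
    SymPow K k V →ₗ[K] ⨂[K] _ : ULift.{u} (Fin k), V where
  __ := AddCon.lift _ (symmetrizeTensor K k V).toAddMonoidHom (by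
    refine AddCon.addConGen_le.2 ?_
    rintro _ _ ⟨e, v⟩
    rw [AddCon.ker_rel, LinearMap.toAddMonoidHom_coe, symmetrizeTensor_tprod,
      symmetrizeTensor_tprod]
    congr 1
    exact (Fintype.sum_equiv (Equiv.mulRight e) _ _ fun σ => by simp [Equiv.Perm.mul_def]))
  map_smul' r x := by
    induction x using AddCon.induction_on with
    | H x => exact LinearMap.map_smul (symmetrizeTensor K k V) r x

theorem symPowSection_comp_mk (k : ℕ) :
    symPowSection K k V ∘ₗ SymmetricPower.mk K (ULift.{u} (Fin k)) V =
      symmetrizeTensor K k V := rfl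

theorem mk_comp_symPowSection [CharZero K] (k : ℕ) :
    SymmetricPower.mk K (ULift.{u} (Fin k)) V ∘ₗ symPowSection K k V = LinearMap.id := by
  refine symPow_hom_ext fun v => ?_
  change SymmetricPower.mk K (ULift.{u} (Fin k)) V
    (symmetrizeTensor K k V (PiTensorProduct.tprod K v)) = _
  rw [symmetrizeTensor_tprod, map_smul, map_sum]
  have (σ : Equiv.Perm (ULift.{u} (Fin k))) :
      SymmetricPower.mk K (ULift.{u} (Fin k)) V (PiTensorProduct.tprod K fun i => v (σ.symm i)) =
        SymmetricPower.tprod K v := SymmetricPower.tprod_equiv σ.symm v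
  simp only [this, Finset.sum_const, Finset.card_univ, Fintype.card_perm, Fintype.card_ulift,
    Fintype.card_fin, LinearMap.id_apply]
  rw [← Nat.cast_smul_eq_nsmul K, inv_smul_smul₀ (Nat.cast_ne_zero.2 k.factorial_ne_zero)]

instance [FiniteDimensional K V] (k : ℕ) : FiniteDimensional K (SymPow K k V) :=
  Module.Finite.of_surjective (SymmetricPower.mk K (ULift.{u} (Fin k)) V)
    (LinearMap.range_eq_top.1 (SymmetricPower.range_mk K (ULift.{u} (Fin k)) V))

/-- The section by averaging exhibits S^k f as projection ∘ f^{⊗k} ∘ section. Cyclicity of the trace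
moves the projection to the other end, leaving f^{⊗k} composed with the average of all permutations.
-/
theorem trace_symPowMap [CharZero K] [FiniteDimensional K V] (k : ℕ) {n : ℕ}
    (b : Basis (Fin n) K V) (f : V →ₗ[K] V) (hf : (LinearMap.toMatrix b b f).IsLowerTriangular) :
    LinearMap.trace K (SymPow K k V) (symPowMap k f) =
      MvPolynomial.eval (fun i => LinearMap.toMatrix b b f i i)
        (MvPolynomial.hsymm (Fin n) K k) := by
  have h1 : symPowMap k f = SymmetricPower.mk K (ULift.{u} (Fin k)) V ∘ₗ
      ((PiTensorProduct.map fun _ => f) ∘ₗ symPowSection K k V) := by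
    have h2 : SymmetricPower.mk K (ULift.{u} (Fin k)) V ∘ₗ (PiTensorProduct.map fun _ => f) =
        symPowMap k f ∘ₗ SymmetricPower.mk K (ULift.{u} (Fin k)) V := rfl
    rw [← LinearMap.comp_assoc, h2, LinearMap.comp_assoc, mk_comp_symPowSection,
      LinearMap.comp_id]
  rw [h1, LinearMap.trace_comp_comm', LinearMap.comp_assoc, symPowSection_comp_mk,
    symmetrizeTensor, LinearMap.comp_smul, ← Module.End.mul_eq_comp, Finset.mul_sum, map_smul, map_sum]
  simp only [Module.End.mul_eq_comp]
  rw [Finset.sum_congr rfl fun σ _ => trace_map_comp_reindex b f hf σ,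
    sum_perm_sum_fixed (k := k) (by simp) fun i => LinearMap.toMatrix b b f i i, smul_eq_mul,
    inv_mul_cancel_left₀ (Nat.cast_ne_zero.2 k.factorial_ne_zero)]

end SymPow

/-! ### Eigenvalues -/

theorem map_diag_eq_of_charpoly_eq {K : Type u} [Field K] {V : Type v} [AddCommGroup V]
    [Module K V] [FiniteDimensional K V] {n : ℕ} (b : Basis (Fin n) K V) (f : V →ₗ[K] V)
    (hf : (LinearMap.toMatrix b b f).IsLowerTriangular) {x : Fin n → K}
    (hx : f.charpoly = ∏ i, (Polynomial.X - Polynomial.C (x i))) :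
    Multiset.map (fun i => LinearMap.toMatrix b b f i i) Finset.univ.val =
      Multiset.map x Finset.univ.val := by
  have h : (LinearMap.toMatrix b b f).charpoly =
      ∏ i, (Polynomial.X - Polynomial.C (LinearMap.toMatrix b b f i i)) := by
    rw [← Matrix.charpoly_transpose, Matrix.charpoly_of_isUpperTriangular]
    · rfl
    · exact fun i j hij => hf hij
  rw [LinearMap.charpoly_toMatrix, hx] at h
  have hr (y : Fin n → K) : (∏ i, (Polynomial.X - Polynomial.C (y i))).roots =
      Multiset.map y Finset.univ.val := by
    rw [Finset.prod, ← Polynomial.roots_multiset_prod_X_sub_C (Multiset.map y Finset.univ.val),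
      Multiset.map_map]
    rfl
  rw [← hr, ← hr, h]

theorem trace_symPowMap_pow {K : Type u} [Field K] [CharZero K] [IsAlgClosed K] {V : Type v}
    [AddCommGroup V] [Module K V] [FiniteDimensional K V] (k a : ℕ) (f : V →ₗ[K] V)
    {x : Fin (finrank K V) → K} (hx : f.charpoly = ∏ i, (Polynomial.X - Polynomial.C (x i))) :
    LinearMap.trace K (SymPow K k V) (symPowMap k (f ^ a)) =
      MvPolynomial.eval x
        (MvPolynomial.expand a (MvPolynomial.hsymm (Fin (finrank K V)) K k)) := by
  obtain ⟨b, hb⟩ := exists_isLowerTriangular_basis (finrank K V) rfl f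
  -- One basis triangularizes every power of f, with diagonal entries raised to that power. The
  -- diagonal agrees with x only up to order, which suffices because h_k is symmetric.
  have hpow := Matrix.IsLowerTriangular.pow_and_diag hb a
  rw [LinearMap.toMatrix_pow] at hpow
  rw [trace_symPowMap k b _ hpow.1, MvPolynomial.eval_expand]
  refine eval_hsymm_congr k ?_
  have h := congrArg (Multiset.map (· ^ a)) (map_diag_eq_of_charpoly_eq b f hb hx)
  rw [Multiset.map_map, Multiset.map_map] at h
  simp only [hpow.2]
  exact h

theorem trace_map_comp_reindex_eq_prod {K : Type u} [Field K] [IsAlgClosed K] {V : Type v}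
    [AddCommGroup V] [Module K V] [FiniteDimensional K V] {ι : Type*} [Fintype ι] [DecidableEq ι]
    (f : V →ₗ[K] V) (σ : Equiv.Perm ι) :
    LinearMap.trace K (⨂[K] _ : ι, V) (PiTensorProduct.map (fun _ => f) ∘ₗ
        (PiTensorProduct.reindex K (fun _ : ι => V) σ).toLinearMap) =
      (σ.partition.parts.map fun a => LinearMap.trace K V (f ^ a)).prod := by
  obtain ⟨b, hb⟩ := exists_isLowerTriangular_basis (finrank K V) rfl f
  rw [trace_map_comp_reindex b f hb σ,
    sum_prod_fixed σ fun i => LinearMap.toMatrix b b f i i]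
  congr 2
  funext a
  rw [LinearMap.trace_eq_matrix_trace K b, ← LinearMap.toMatrix_pow, Matrix.trace]
  exact Finset.sum_congr rfl fun i _ => ((Matrix.IsLowerTriangular.pow_and_diag hb a).2 i).symm

/-! ### Traces on images of elements of a group algebra -/

/-- Let J be a left ideal complementary to Rc and write 1 = x c + j with j in J. Then c j = c - c x
c lies in both Rc and J, hence is zero. -/
theorem exists_mul_mul_eq_self {R : Type*} [Ring R] [IsSemisimpleRing R] (c : R) :
    ∃ x, c * x * c = c := by
  obtain ⟨J, hJ⟩ := exists_isCompl (Ideal.span {c} : Submodule R R)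
  have h1 : (1 : R) ∈ (Ideal.span {c} : Submodule R R) ⊔ J := by
    rw [hJ.sup_eq_top]
    trivial
  obtain ⟨e, he, j, hj, hej⟩ := Submodule.mem_sup.1 h1
  obtain ⟨x, rfl⟩ := Ideal.mem_span_singleton'.1 he
  have hc : c * (x * c) + c * j = c := by rw [← mul_add, hej, mul_one]
  have hcj : c * j ∈ (Ideal.span {c} : Submodule R R) ⊓ J := by
    refine ⟨?_, J.smul_mem c hj⟩
    rw [eq_sub_of_add_eq' hc]
    exact Submodule.sub_mem _ (Ideal.mem_span_singleton_self c)
      (Ideal.mul_mem_left _ _ (Ideal.mul_mem_left _ _ (Ideal.mem_span_singleton_self c)))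
  rw [hJ.inf_eq_bot, Submodule.mem_bot] at hcj
  exact ⟨x, by rwa [hcj, add_zero, ← mul_assoc] at hc⟩

/-- The hypothesis makes C X a projection onto the range of C, so f C X maps into that range and
agrees with f on it. -/
theorem trace_restrict_range {K V : Type*} [Field K] [AddCommGroup V] [Module K V]
    [FiniteDimensional K V] {C X : V →ₗ[K] V} (h : C ∘ₗ X ∘ₗ C = C) (f : V →ₗ[K] V)
    (hf : ∀ x ∈ LinearMap.range C, f x ∈ LinearMap.range C) :
    LinearMap.trace K (LinearMap.range C) (f.restrict hf) =
      LinearMap.trace K V (f ∘ₗ C ∘ₗ X) := by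
  have hm : ∀ x, (f ∘ₗ C ∘ₗ X) x ∈ LinearMap.range C := fun x => hf _ ⟨X x, rfl⟩
  rw [← LinearMap.trace_restrict_eq_of_forall_mem (LinearMap.range C) (f ∘ₗ C ∘ₗ X) hm]
  congr 1
  ext ⟨_, x, rfl⟩
  exact congrArg f (LinearMap.congr_fun h x).symm

/-- In the basis of group elements, the diagonal entry at z is the coefficient of z in σ z e. -/
theorem trace_mulLeft_comp_mulRight {K G : Type*} [Field K] [Group G] [Fintype G] (σ : G)
    (e : MonoidAlgebra K G) :
    LinearMap.trace K (MonoidAlgebra K G)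
        (LinearMap.mulLeft K (MonoidAlgebra.of K G σ) ∘ₗ LinearMap.mulRight K e) =
      ∑ z, e.coeff (z⁻¹ * σ⁻¹ * z) := by
  classical
  rw [LinearMap.trace_eq_matrix_trace K (MonoidAlgebra.basis G K), Matrix.trace]
  refine Finset.sum_congr rfl fun z _ => ?_
  rw [Matrix.diag_apply, LinearMap.toMatrix_apply, MonoidAlgebra.basis_apply,
    LinearMap.comp_apply, LinearMap.mulRight_apply, LinearMap.mulLeft_apply,
    MonoidAlgebra.of_apply, ← mul_assoc, MonoidAlgebra.single_mul_single, mul_one]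
  change (MonoidAlgebra.single (σ * z) 1 * e).coeff z = _
  rw [MonoidAlgebra.coeff_single_mul_apply, one_mul, mul_inv_rev]

/-- For each fixed z, the substitution σ = z τ⁻¹ z⁻¹ turns the inner sum into ∑ e_τ φ(τ). The
inverse comes from the trace formula, which is why φ must be invariant under inversion as well as
conjugation. -/
theorem sum_trace_mul_classFunction {K G : Type*} [Field K] [Group G] [Fintype G]
    (e : MonoidAlgebra K G) (φ : G → K) (hφ : ∀ z τ, φ (z * τ⁻¹ * z⁻¹) = φ τ) :
    ∑ σ, LinearMap.trace K (MonoidAlgebra K G)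
        (LinearMap.mulLeft K (MonoidAlgebra.of K G σ) ∘ₗ LinearMap.mulRight K e) * φ σ =
      Fintype.card G * ∑ τ, e.coeff τ * φ τ := by
  simp only [trace_mulLeft_comp_mulRight, Finset.sum_mul]
  rw [Finset.sum_comm, ← nsmul_eq_mul, ← Finset.card_univ, ← Finset.sum_const]
  refine Finset.sum_congr rfl fun z _ => ?_
  refine (Fintype.sum_equiv ((Equiv.inv G).trans (MulAut.conj z).toEquiv) _ _ fun τ => ?_).symm
  simp only [Equiv.trans_apply, Equiv.inv_apply, MulEquiv.toEquiv_eq_coe, MulEquiv.coe_toEquiv,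
    MulAut.conj_apply, hφ]
  congr 2
  group

theorem trace_comp_asAlgebraHom {K G V : Type*} [Field K] [Group G] [Fintype G] [AddCommGroup V]
    [Module K V] (ρ : Representation K G V) (f : V →ₗ[K] V)
    (y : MonoidAlgebra K G) :
    LinearMap.trace K V (f ∘ₗ ρ.asAlgebraHom y) =
      ∑ σ, y.coeff σ * LinearMap.trace K V (f ∘ₗ ρ σ) := by
  have hy : y = ∑ σ, MonoidAlgebra.single σ (y.coeff σ) := by
    conv_lhs => rw [← MonoidAlgebra.sum_coeff_single y]
    exact Finsupp.sum_fintype _ _ fun σ => MonoidAlgebra.single_zero σ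
  conv_lhs => rw [hy]
  rw [map_sum, ← Module.End.mul_eq_comp, Finset.mul_sum, map_sum]
  refine Finset.sum_congr rfl fun σ _ => ?_
  rw [Representation.asAlgebraHom_single, mul_smul_comm, map_smul, smul_eq_mul,
    Module.End.mul_eq_comp]

/-! ### Characters of Schur functors -/

section Schur

variable {K : Type u} [Field K] {d : ℕ} {μ : YoungDiagram} (T : Fin d ≃ μ.cells)

theorem partition_conj_inv {ι : Type*} [Fintype ι] [DecidableEq ι] (z τ : Equiv.Perm ι) :
    (z * τ⁻¹ * z⁻¹).partition = τ.partition := by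
  refine Eq.trans (Equiv.Perm.partition_eq_of_isConj.1 (isConj_iff.2 ⟨z, rfl⟩)).symm ?_
  refine Nat.Partition.ext ?_
  rw [Equiv.Perm.parts_partition, Equiv.Perm.parts_partition, Equiv.Perm.cycleType_inv,
    Equiv.Perm.support_inv]

theorem trace_schurRep_eq_sum_perm [CharZero K] [IsAlgClosed K] {G : Type*} [Monoid G]
    {V : Type v} [AddCommGroup V] [Module K V] [FiniteDimensional K V]
    (ρ : Representation K G V) (g : G) :
    LinearMap.trace K _ (schurRep T ρ g) =
      (d.factorial : K)⁻¹ * ∑ σ : Equiv.Perm (Fin d), (spechtRep K T).character σ *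
        (σ.partition.parts.map fun a => LinearMap.trace K V (ρ g ^ a)).prod := by
  set c := youngSymmetrizer K T
  obtain ⟨x, hx⟩ := exists_mul_mul_eq_self c
  set π := permRep K V d
  set φ : Equiv.Perm (Fin d) → K := fun σ =>
    (σ.partition.parts.map fun a => LinearMap.trace K V (ρ g ^ a)).prod with hφ
  have htr (σ : Equiv.Perm (Fin d)) :
      LinearMap.trace K _ (tensorPowerRep d ρ g ∘ₗ π σ) = φ σ :=
    trace_map_comp_reindex_eq_prod (ρ g) σ
  have h1 : LinearMap.trace K _ (schurRep T ρ g) =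
      LinearMap.trace K _ (tensorPowerRep d ρ g ∘ₗ π.asAlgebraHom c ∘ₗ π.asAlgebraHom x) := by
    refine trace_restrict_range ?_ _ fun y hy => (schurRep T ρ g ⟨y, hy⟩).2
    rw [← Module.End.mul_eq_comp, ← Module.End.mul_eq_comp, ← map_mul, ← map_mul, ← mul_assoc, hx]
  -- The action of c commutes with g, so cyclicity of the trace replaces c x by x c, the element
  -- that also appears in the Specht character.
  have h2 : LinearMap.trace K _ (schurRep T ρ g) =
      LinearMap.trace K _ (tensorPowerRep d ρ g ∘ₗ π.asAlgebraHom (x * c)) := by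
    have hcomm : tensorPowerRep d ρ g ∘ₗ π.asAlgebraHom c =
        π.asAlgebraHom c ∘ₗ tensorPowerRep d ρ g := tensorPowerRep_commute_permRep ρ g c
    rw [h1, ← LinearMap.comp_assoc, hcomm, LinearMap.comp_assoc, LinearMap.trace_comp_comm',
      map_mul, Module.End.mul_eq_comp, LinearMap.comp_assoc]
  -- Right multiplication reverses products: multiplying by x * c means applying x first and c
  -- second. The projection onto the left ideal is thus already given by x * c.
  have h3 (σ : Equiv.Perm (Fin d)) : (spechtRep K T).character σ =
      LinearMap.trace K _ (LinearMap.mulLeft K (MonoidAlgebra.of K (Equiv.Perm (Fin d)) σ) ∘ₗ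
        LinearMap.mulRight K (x * c)) := by
    rw [LinearMap.mulRight_mul]
    refine trace_restrict_range ?_ _ fun y hy => (spechtRep K T σ ⟨y, hy⟩).2
    rw [← LinearMap.mulRight_mul, ← LinearMap.mulRight_mul]
    exact congrArg _ hx
  simp only [h3]
  rw [sum_trace_mul_classFunction (x * c) φ fun z τ => by simp only [hφ, partition_conj_inv],
    Fintype.card_perm, Fintype.card_fin,
    inv_mul_cancel_left₀ (Nat.cast_ne_zero.2 d.factorial_ne_zero), h2, trace_comp_asAlgebraHom]
  simp only [htr]

theorem sum_partition_eq_sum_perm {A : Type*} [CommRing A] [Algebra K A]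
    (F : ℕ → A) :
    ∑ α : d.Partition, (spechtCharacter K T α * ((numCycleType α : K) / (d.factorial : K))) •
        (α.parts.map F).prod =
      (d.factorial : K)⁻¹ • ∑ σ : Equiv.Perm (Fin d), (spechtRep K T).character σ •
        (σ.partition.parts.map F).prod := by
  classical
  -- `σ.partition` is a partition of `Fintype.card (Fin d)`; it is repackaged as a partition of d to
  -- index the fibres.
  let t (σ : Equiv.Perm (Fin d)) : d.Partition :=
    ⟨σ.partition.parts, σ.partition.parts_pos, by simp [σ.partition.parts_sum]⟩
  have ht (σ : Equiv.Perm (Fin d)) (α : d.Partition) : t σ = α ↔ HasCycleType σ α :=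
    Nat.Partition.ext_iff
  rw [← Finset.sum_fiberwise Finset.univ t, Finset.smul_sum]
  refine Finset.sum_congr rfl fun α _ => ?_
  have h : ∀ σ ∈ Finset.univ.filter (fun σ => t σ = α),
      (spechtRep K T).character σ • (σ.partition.parts.map F).prod =
        spechtCharacter K T α • (α.parts.map F).prod := fun σ hσ => by
    have hσ := (ht σ α).1 (Finset.mem_filter.1 hσ).2
    rw [spechtCharacter_eq K T hσ, hσ]
  have hcard : (Finset.univ.filter (fun σ => t σ = α)).card = numCycleType α := by
    rw [numCycleType, Nat.card_eq_fintype_card, Fintype.card_subtype]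
    simp only [ht]
  rw [Finset.sum_congr rfl h, Finset.sum_const, hcard, ← Nat.cast_smul_eq_nsmul K, smul_smul,
    smul_smul]
  congr 1
  ring

end Schur

/-! ### Characters of `GL(W)` -/

theorem isSymmetric_expand {σ R : Type*} [CommRing R] {p : MvPolynomial σ R}
    (hp : p.IsSymmetric) (a : ℕ) : (MvPolynomial.expand a p).IsSymmetric := by
  intro e
  conv_rhs => rw [← hp e]
  have : (MvPolynomial.rename e).comp (MvPolynomial.expand a) =
      (MvPolynomial.expand a).comp (MvPolynomial.rename e : MvPolynomial σ R →ₐ[R] _) := by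
    ext i
    simp
  exact DFunLike.congr_fun this p

theorem isSymmetric_psiCompH (K : Type u) [Field K] (n k : ℕ) {d : ℕ} (α : d.Partition) :
    (psiCompH K n k α).IsSymmetric := by
  refine (MvPolynomial.mem_symmetricSubalgebra _).1 (Subalgebra.multiset_prod_mem _ fun p hp => ?_)
  obtain ⟨a, -, rfl⟩ := Multiset.mem_map.1 hp
  exact isSymmetric_expand (MvPolynomial.hsymm_isSymmetric _ _ k) a

theorem IsGLCharacter.unique {K : Type u} [Field K] [CharZero K] {W : Type v} [AddCommGroup W]
    [Module K W] [FiniteDimensional K W] {V : Type w} [AddCommMonoid V] [Module K V]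
    {ρ : Representation K (LinearMap.GeneralLinearGroup K W) V}
    {P Q : MvPolynomial (Fin (finrank K W)) K} (hP : IsGLCharacter ρ P)
    (hQ : IsGLCharacter ρ Q) : P = Q := by
  -- Only points with nonzero coordinates are eigenvalue lists of invertible maps; the nonzero
  -- scalars still form an infinite set, so such points determine a polynomial.
  refine MvPolynomial.funext_set (fun _ => {0}ᶜ) (fun _ => (Set.finite_singleton _).infinite_compl)
    fun x hx => ?_
  have hx (i) : x i ≠ 0 := hx i trivial
  let b := finBasis K W
  have hmul (y z : Fin (finrank K W) → K) (h : ∀ i, y i * z i = 1) :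
      Matrix.toLin b b (Matrix.diagonal y) * Matrix.toLin b b (Matrix.diagonal z) = 1 := by
    rw [Module.End.mul_eq_comp, ← Matrix.toLin_mul, Matrix.diagonal_mul_diagonal]
    simp only [h, Matrix.diagonal_one, Matrix.toLin_one]
    rfl
  let g : LinearMap.GeneralLinearGroup K W :=
    ⟨Matrix.toLin b b (Matrix.diagonal x), Matrix.toLin b b (Matrix.diagonal fun i => (x i)⁻¹),
      hmul _ _ fun i => mul_inv_cancel₀ (hx i), hmul _ _ fun i => inv_mul_cancel₀ (hx i)⟩
  have hg : (g : W →ₗ[K] W).charpoly = ∏ i, (Polynomial.X - Polynomial.C (x i)) := by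
    change (Matrix.toLin b b (Matrix.diagonal x)).charpoly = _
    rw [← LinearMap.charpoly_toMatrix _ b, LinearMap.toMatrix_toLin,
      Matrix.charpoly_of_isUpperTriangular _ (Matrix.blockTriangular_diagonal x)]
    simp
  rw [← hP.2 g x hg, ← hQ.2 g x hg]

theorem isGLCharacter_schurRep_symPowRep {K : Type u} [Field K] [CharZero K] [IsAlgClosed K]
    {W : Type v} [AddCommGroup W] [Module K W] [FiniteDimensional K W] (k d : ℕ)
    (μ : YoungDiagram) (T : Fin d ≃ μ.cells) :
    IsGLCharacter (schurRep T (symPowRep k (standardRep K W)))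
      (∑ α : d.Partition, (spechtCharacter K T α * ((numCycleType α : K) / (d.factorial : K))) •
        psiCompH K (finrank K W) k α) := by
  refine ⟨(MvPolynomial.mem_symmetricSubalgebra _).1 (Subalgebra.sum_mem _ fun α _ =>
    Subalgebra.smul_mem _ ((MvPolynomial.mem_symmetricSubalgebra _).2
      (isSymmetric_psiCompH K _ k α)) _), fun g x hx => ?_⟩
  rw [trace_schurRep_eq_sum_perm]
  simp only [psiCompH]
  rw [sum_partition_eq_sum_perm T, MvPolynomial.smul_eval, map_sum]
  congr 1
  refine Finset.sum_congr rfl fun σ _ => ?_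
  rw [MvPolynomial.smul_eval, map_multiset_prod, Multiset.map_map]
  congr 2
  refine Multiset.map_congr rfl fun a _ => ?_
  -- The a-th power of the action of g on S^k W is the action of g ^ a, whose trace is h_k(x^a).
  rw [Function.comp_apply, ← trace_symPowMap_pow k a _ hx, ← map_pow]
  rfl

end Plethysm

end

theorem proposition2p4 {K : Type u} [Field K] [CharZero K] [IsAlgClosed K] {W : Type v}
    [AddCommGroup W] [Module K W] [FiniteDimensional K W] (k d : ℕ) (μ : YoungDiagram)
    (T : Fin d ≃ μ.cells) (P : MvPolynomial (Fin (Module.finrank K W)) K) :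
    IsGLCharacter (schurRep T (symPowRep k (standardRep K W))) P ↔
      P = ∑ α : d.Partition,
        (spechtCharacter K T α * ((numCycleType α : K) / (d.factorial : K))) •
          psiCompH K (Module.finrank K W) k α := by
  refine ⟨fun h => h.unique (isGLCharacter_schurRep_symPowRep k d μ T), ?_⟩
  rintro rfl
  exact isGLCharacter_schurRep_symPowRep k d μ T
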